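/- **Theorem.** Let $A\in\mathbb{R}^{m\times n}$ have columns $\mathbf a_1,\dots,\mathbf a_n$, let $\mathbf b\in\mathbb{R}^m$, $\mathbf c\in\mathbb{R}^n$ ($m,n\ge 1$), and consider the linear program $$\max\{\langle \mathbf c,\mathbf x\rangle : \mathbf x\in\mathcal F_p\},\qquad \mathcal F_p=\{\mathbf x\in\mathbb{R}^n : A\mathbf x\le \mathbf b,\ \mathbf 0\le \mathbf x\le \mathbf 1\}.$$ Put $\mathbf d=\mathbf b/n$ and assume: * (A1) $\max_i d_i=\bar d\ge\min_i d_i=\underline d>0$; * (A2) $\|\mathbf a_j\|_\infty\le\bar a$ and $|c_j|\le\bar c$ for all $j$; * (A3) for every $\mathbf y\ge\mathbf 0$ in $\mathbb{R}^m$, at most $m$ of the columns satisfy $c_j=\langle \mathbf a_j,\mathbf y\rangle$. Let $\gamma=\sqrt{\frac{2\bar c}{\underline d(\bar a+\bar d)^2mn}}$ and let $\sigma$ be a uniformly random permutation of $\{1,\dots,n\}$. Starting from $\mathbf y^1=\mathbf 0$, compute for $k=1,\dots,n$ $$\hat x_{\sigma(k)}=\mathbb{I}\{c_{\sigma(k)}>\langle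 \mathbf a_{\sigma(k)},\mathbf y^k\rangle\},\qquad \mathbf y^{k+1}=\big[\mathbf y^k-\gamma(\mathbf d-\hat x_{\sigma(k)}\,\mathbf a_{\sigma(k)})\big]_+ ,$$ where $[\cdot]_+$ is the entrywise positive part. Then, with expectation over $\sigma$, $$\mathbb E\Big[\max_{\mathbf x\in\mathcal F_p}\langle \mathbf c,\mathbf x\rangle-\langle \mathbf c,\hat{\mathbf x}\rangle\Big]\le C\big(m\log n+\sqrt n\log n\big)+\Big(\frac{(\bar a+\bar d)^2\bar c}{2\underline d}\Big)^{1/2}\sqrt{mn},$$ $$\mathbb E\big[\|[A\hat{\mathbf x}-\mathbf b]_+\|\big]\le\frac{m(\bar a+\bar d)^2}{\underline d}+\sqrt m(\bar a+\bar d)+\Big(\frac{(\bar a+\bar d)^2\bar c}{2\underline d}\Big)^{1/2}\sqrt{mn},$$ where $\|\cdot\|$ is the Euclidean norm and the constant $C$ depends only on $\bar a$, $\bar c$ and $\underline d$. -/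

import Mathlib

open scoped BigOperators Matrix

noncomputable section

namespace OnlineLP

variable {m n : ℕ}

/-- The primal feasible set `{x : A x ≤ b, 0 ≤ x ≤ 1}`. -/
def feasibleSet (A : Matrix (Fin m) (Fin n) ℝ) (b : Fin m → ℝ) : Set (Fin n → ℝ) :=
  {x | A *ᵥ x ≤ b ∧ 0 ≤ x ∧ x ≤ 1}

/-- The optimal value `max {⟨c, x⟩ : A x ≤ b, 0 ≤ x ≤ 1}` of the linear program. -/
def optValue (A : Matrix (Fin m) (Fin n) ℝ) (b : Fin m → ℝ) (c : Fin n → ℝ) : ℝ :=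
  sSup ((fun x => c ⬝ᵥ x) '' feasibleSet A b)

/-- For `b ≥ 0` the supremum in `optValue` is an attained maximum. -/
theorem optValue_isGreatest (A : Matrix (Fin m) (Fin n) ℝ) (b : Fin m → ℝ) (c : Fin n → ℝ)
    (hb : 0 ≤ b) : IsGreatest ((fun x => c ⬝ᵥ x) '' feasibleSet A b) (optValue A b c) := by
  have hc : IsCompact (feasibleSet A b) := by
    have h : feasibleSet A b = {x | A *ᵥ x ≤ b} ∩ Set.Icc 0 1 := by
      ext x; simp [feasibleSet]
    rw [h]
    refine isCompact_Icc.inter_left (isClosed_le ?_ continuous_const)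
    exact Continuous.matrix_mulVec continuous_const continuous_id
  have hne : (feasibleSet A b).Nonempty :=
    ⟨0, by simpa using hb, le_refl _, fun _ => by simp⟩
  have hf : Continuous fun x : Fin n → ℝ => c ⬝ᵥ x :=
    Continuous.dotProduct continuous_const continuous_id
  exact (hc.image hf).isGreatest_sSup (hne.image _)

/-- The average right-hand side `d = b / n`. -/
def avgRhs (n : ℕ) (b : Fin m → ℝ) : Fin m → ℝ := fun i => b i / n

/-- The standing assumptions on the linear program `max {⟨c, x⟩ : A x ≤ b, 0 ≤ x ≤ 1}`.
Since a maximum and a positive minimum of the entries of `b / n` exist, `m` and `n` are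
positive. -/
structure Assumptions (A : Matrix (Fin m) (Fin n) ℝ) (b : Fin m → ℝ) (c : Fin n → ℝ)
    (abar cbar dlow dbar : ℝ) : Prop where
  max_rhs : IsGreatest (Set.range (avgRhs n b)) dbar
  min_rhs : IsLeast (Set.range (avgRhs n b)) dlow
  dlow_pos : 0 < dlow
  col_bound : ∀ j i, |A i j| ≤ abar
  cost_bound : ∀ j, |c j| ≤ cbar
  tight_cols : ∀ y : Fin m → ℝ, 0 ≤ y → Set.ncard {j | c j = A.col j ⬝ᵥ y} ≤ m

/-- The primal estimate `𝕀{cⱼ > ⟨aⱼ, y⟩}` made from a column `aⱼ`, its cost `cⱼ` and the dual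
iterate `y`. -/
def primalEstimate (a : Fin m → ℝ) (cj : ℝ) (y : Fin m → ℝ) : ℝ :=
  open Classical in if a ⬝ᵥ y < cj then 1 else 0

/-- The subgradient `d - aⱼ 𝕀{cⱼ > ⟨aⱼ, y⟩}` at `y` of `y ↦ ⟨d, y⟩ + [cⱼ - ⟨aⱼ, y⟩]₊`. -/
def subgrad (d a : Fin m → ℝ) (cj : ℝ) (y : Fin m → ℝ) : Fin m → ℝ :=
  d - primalEstimate a cj y • a

/-- One explicit (projected subgradient) dual update `[y - γ (d - aⱼ xⱼ)]₊`. -/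
def dualStep (γ : ℝ) (d a : Fin m → ℝ) (cj : ℝ) (y : Fin m → ℝ) : Fin m → ℝ :=
  fun i => max (y i - γ * subgrad d a cj y i) 0

/-- The update is the minimizer over `z ≥ 0` of the linearized dual objective plus the proximal
term `(1 / (2γ)) ‖z - y‖²`. -/
theorem dualStep_isMinOn (γ : ℝ) (hγ : 0 < γ) (d a : Fin m → ℝ) (cj : ℝ) (y : Fin m → ℝ) :
    0 ≤ dualStep γ d a cj y ∧
    IsMinOn (fun z => subgrad d a cj y ⬝ᵥ (z - y) + 1 / (2 * γ) * ‖WithLp.toLp 2 (z - y)‖ ^ 2)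
      {z | 0 ≤ z} (dualStep γ d a cj y) := by
  refine ⟨fun i => le_max_right _ _, ?_⟩
  intro z hz
  simp only [Set.mem_ofPred_eq, EuclideanSpace.norm_sq_eq, dotProduct, Finset.mul_sum,
    ← Finset.sum_add_distrib]
  refine Finset.sum_le_sum fun i _ => ?_
  have hzi : 0 ≤ z i := hz i
  simp only [Pi.sub_apply, Real.norm_eq_abs, sq_abs, dualStep]
  set g := subgrad d a cj y i
  set w := max (y i - γ * g) 0 with hw
  have key : 0 ≤ (z i - w) * (w - (y i - γ * g)) := by
    rcases le_total (y i - γ * g) 0 with h | h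
    · rw [hw, max_eq_right h]
      exact mul_nonneg (by linarith) (by linarith)
    · rw [hw, max_eq_left h]
      simp
  have e : g * (z i - y i) + 1 / (2 * γ) * (z i - y i) ^ 2 -
      (g * (w - y i) + 1 / (2 * γ) * (w - y i) ^ 2) =
      1 / γ * ((z i - w) * (w - (y i - γ * g))) + 1 / (2 * γ) * (z i - w) ^ 2 := by
    field_simp
    ring
  have h1 : 0 ≤ 1 / γ * ((z i - w) * (w - (y i - γ * g))) + 1 / (2 * γ) * (z i - w) ^ 2 := by
    positivity
  linarith

/-- The dual iterates of the online algorithm with constant stepsize `γ` when the columns are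
processed in the order `σ 0, σ 1, …, σ (n - 1)`, started from `0`: `dualIter … k` is the dual
vector available when the column `σ k` arrives. -/
def dualIter (A : Matrix (Fin m) (Fin n) ℝ) (b : Fin m → ℝ) (c : Fin n → ℝ) (γ : ℝ)
    (σ : Equiv.Perm (Fin n)) : ℕ → Fin m → ℝ
  | 0 => 0
  | k + 1 =>
    if h : k < n then
      dualStep γ (avgRhs n b) (A.col (σ ⟨k, h⟩)) (c (σ ⟨k, h⟩)) (dualIter A b c γ σ k)
    else dualIter A b c γ σ k

/-- The output `x̂` of the online algorithm: the entry of the column `j = σ k` is the estimate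
made at step `k`. -/
def output (A : Matrix (Fin m) (Fin n) ℝ) (b : Fin m → ℝ) (c : Fin n → ℝ) (γ : ℝ)
    (σ : Equiv.Perm (Fin n)) : Fin n → ℝ :=
  fun j => primalEstimate (A.col j) (c j) (dualIter A b c γ σ (σ.symm j : ℕ))

/-- The optimality gap `ρ(x) = max {⟨c, z⟩ : A z ≤ b, 0 ≤ z ≤ 1} - ⟨c, x⟩`. -/
def optGap (A : Matrix (Fin m) (Fin n) ℝ) (b : Fin m → ℝ) (c : Fin n → ℝ)
    (x : Fin n → ℝ) : ℝ :=
  optValue A b c - c ⬝ᵥ x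

/-- The constraint violation `v(x) = ‖[A x - b]₊‖`, in the Euclidean norm. -/
def violation (A : Matrix (Fin m) (Fin n) ℝ) (b : Fin m → ℝ) (x : Fin n → ℝ) : ℝ :=
  ‖WithLp.toLp 2 (fun i => max ((A *ᵥ x) i - b i) 0)‖

/-- The stepsize `γ = √(2 c̄ / (d̲ (ā + d̄)² m n))`. -/
def stepsize (m n : ℕ) (abar cbar dlow dbar : ℝ) : ℝ :=
  Real.sqrt (2 * cbar / (dlow * (abar + dbar) ^ 2 * m * n))

end OnlineLP

end

/-! Write `G = abar + dbar`. With `g` the subgradient used at a step, the reward collected there is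
the column's dual objective at the current iterate minus `⟨g, y⟩` (`dualObj_eq`). Telescoping `‖y‖²`
bounds the sum of these products by `γ n m G² / 2` for every order, so the gap reduces to comparing
the optimum with the dual objectives along the iterates.

Given the past, the next column is uniform among the `s = n - k` unseen ones (`expect_dualObj_eq`).
The average dual objective of these columns is bounded below by weak duality (`sum_dualObj_ge`),
tested at an optimal `x` of the full program. Restricted to the unseen columns, `x` is feasible up
to the deviation of a sum sampled without replacement, which is of order `√s (log (m + 1) + 2)` in
expectation (`exists_perm_sum_bound`). Dividing by `s` and summing over `k` gives `√n log n` if `m <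
n`; otherwise trivial bounds give `m log n`.

The violation bound holds for every order: the last iterate dominates `γ (A x̂ - b)`, and a drift
argument keeps all iterates in a ball (`norm_dualStep_le`). The stepsize balances the two error
terms. -/

namespace OnlineLP

open Finset Real

/-! ### Sampling without replacement: exchangeability and moment generating functions. -/

section Sampling

variable {n : ℕ}

/-- Expectations over a uniformly random permutation are invariant under swapping positions. -/
theorem expect_perm_swap (F : Equiv.Perm (Fin n) → ℝ) (i t : Fin n) :
    (Finset.expect univ fun σ : Equiv.Perm (Fin n) => F (σ * Equiv.swap i t)) =
      Finset.expect univ fun σ => F σ :=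
  Fintype.expect_equiv (Equiv.mulRight (Equiv.swap i t)) _ _ fun _ => rfl

theorem expect_perm_apply_eq (w : Fin n → ℝ) (i : Fin n) :
    (Finset.expect univ fun σ : Equiv.Perm (Fin n) => w (σ i)) =
      Finset.expect univ fun j => w j := by
  have hn : (n : ℝ) ≠ 0 := by
    have := i.pos
    positivity
  have h1 : ∀ t : Fin n, (Finset.expect univ fun σ : Equiv.Perm (Fin n) => w (σ t)) =
      Finset.expect univ fun σ : Equiv.Perm (Fin n) => w (σ i) := fun t => by
    rw [← expect_perm_swap _ i t]
    simp
  have h2 : ∑ t : Fin n, (Finset.expect univ fun σ : Equiv.Perm (Fin n) => w (σ t)) =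
      ∑ j, w j := by
    rw [← expect_sum_comm]
    simp only [Equiv.sum_comp]
    exact expect_const univ_nonempty _
  simp only [h1, sum_const, card_univ, Fintype.card_fin, nsmul_eq_mul] at h2
  rw [Fintype.expect_eq_sum_div_card, Fintype.expect_eq_sum_div_card (f := fun j => w j), ← h2,
    Fintype.card_fin, Fintype.expect_eq_sum_div_card]
  field_simp

/-- A repeated position only increases the mean: apply `2ab ≤ a² + b²` to `w (σ i)` and `w (σ t)`;
swapping `i` and `t` shows that the two squares contribute equally. -/
theorem expect_prod_mul_le (w : Fin n → ℝ) (hw : ∀ j, 0 ≤ w j) (T : Finset (Fin n))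
    {t i : Fin n} (ht : t ∉ T) (hi : i ∈ T) :
    (Finset.expect univ fun σ : Equiv.Perm (Fin n) => (∏ l ∈ T, w (σ l)) * w (σ t)) ≤
      Finset.expect univ fun σ : Equiv.Perm (Fin n) => (∏ l ∈ T, w (σ l)) * w (σ i) := by
  have hP : ∀ σ : Equiv.Perm (Fin n),
      ∏ l ∈ T, w (σ l) = w (σ i) * ∏ l ∈ T.erase i, w (σ l) :=
    fun σ => (mul_prod_erase T (fun l => w (σ l)) hi).symm
  have hswap : (Finset.expect univ fun σ : Equiv.Perm (Fin n) =>
      (∏ l ∈ T.erase i, w (σ l)) * (w (σ t) * w (σ t))) =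
      Finset.expect univ fun σ : Equiv.Perm (Fin n) => (∏ l ∈ T, w (σ l)) * w (σ i) := by
    rw [← expect_perm_swap _ i t]
    refine expect_congr rfl fun σ _ => ?_
    rw [hP]
    have : ∏ l ∈ T.erase i, w ((σ * Equiv.swap i t) l) = ∏ l ∈ T.erase i, w (σ l) := by
      refine prod_congr rfl fun l hl => ?_
      rw [Equiv.Perm.mul_apply, Equiv.swap_apply_of_ne_of_ne (ne_of_mem_erase hl)]
      rintro rfl
      exact ht (mem_of_mem_erase hl)
    rw [this]
    simp
    ring
  have h2 : (Finset.expect univ fun σ : Equiv.Perm (Fin n) =>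
      2 * ((∏ l ∈ T, w (σ l)) * w (σ t))) ≤
      Finset.expect univ fun σ : Equiv.Perm (Fin n) => ((∏ l ∈ T, w (σ l)) * w (σ i) +
        (∏ l ∈ T.erase i, w (σ l)) * (w (σ t) * w (σ t))) := by
    refine expect_le_expect fun σ _ => ?_
    rw [hP]
    have hQ : 0 ≤ ∏ l ∈ T.erase i, w (σ l) := prod_nonneg fun l _ => hw _
    nlinarith [mul_nonneg hQ (sq_nonneg (w (σ i) - w (σ t)))]
  rw [expect_add_distrib, hswap, ← mul_expect] at h2
  linarith

/-- Hoeffding's comparison of sampling without and with replacement, for products. -/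
theorem expect_prod_perm_le (w : Fin n → ℝ) (hw : ∀ j, 0 ≤ w j) (T : Finset (Fin n)) :
    (Finset.expect univ fun σ : Equiv.Perm (Fin n) => ∏ l ∈ T, w (σ l)) ≤
      (Finset.expect univ fun j => w j) ^ #T := by
  induction T using Finset.induction_on with
  | empty => simp
  | insert t T ht ih =>
    have hn : (0 : ℝ) < n := by exact_mod_cast t.pos
    rw [card_insert_of_notMem ht, pow_succ]
    have hmean : 0 ≤ Finset.expect univ fun j => w j := expect_nonneg fun j _ => hw j
    refine le_trans ?_ (mul_le_mul_of_nonneg_right ih hmean)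
    simp only [prod_insert ht]
    have hle : ∀ i : Fin n,
        (Finset.expect univ fun σ : Equiv.Perm (Fin n) => (∏ l ∈ T, w (σ l)) * w (σ t)) ≤
        Finset.expect univ fun σ : Equiv.Perm (Fin n) => (∏ l ∈ T, w (σ l)) * w (σ i) := by
      intro i
      by_cases hi : i ∈ T
      · exact expect_prod_mul_le w hw T ht hi
      · rw [← expect_perm_swap _ i t]
        refine (expect_congr rfl fun σ _ => ?_).le
        congr 1
        · refine prod_congr rfl fun l hl => ?_
          rw [Equiv.Perm.mul_apply, Equiv.swap_apply_of_ne_of_ne]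
          · rintro rfl
            exact hi hl
          · rintro rfl
            exact ht hl
        · simp
    -- Averaging over all `i` makes the last factor deterministic, since `∑ i, w (σ i)` does not
    -- depend on `σ`.
    have hsum := sum_le_sum fun i (_ : i ∈ (univ : Finset (Fin n))) => hle i
    rw [sum_const, card_univ, Fintype.card_fin, nsmul_eq_mul, ← expect_sum_comm] at hsum
    simp only [← mul_sum, Equiv.sum_comp, ← expect_mul] at hsum
    rw [Fintype.expect_eq_sum_div_card (f := fun j => w j), Fintype.card_fin, ← mul_div_assoc,
      le_div_iff₀ hn]
    simp only [mul_comm (w _)]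
    linarith

/-- The chord of the exponential over `[-lr, lr]`; being affine in `x`, it averages to `cosh (l *
r)` over centered values. -/
theorem exp_mul_le_cosh_add {r x : ℝ} (hr : 0 < r) (l : ℝ) (hx : |x| ≤ r) :
    exp (l * x) ≤ cosh (l * r) + x / r * sinh (l * r) := by
  obtain ⟨h1, h2⟩ := abs_le.1 hx
  have hc := (convexOn_exp.2 (Set.mem_univ (l * r)) (Set.mem_univ (-(l * r))) :)
    (div_nonneg (by linarith) (by linarith) : 0 ≤ (r + x) / (2 * r))
    (div_nonneg (by linarith) (by linarith) : 0 ≤ (r - x) / (2 * r)) (by field_simp; ring)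
  simp only [smul_eq_mul] at hc
  have e : (r + x) / (2 * r) * (l * r) + (r - x) / (2 * r) * -(l * r) = l * x := by
    field_simp
    ring
  rw [e] at hc
  refine hc.trans (le_of_eq ?_)
  rw [cosh_eq, sinh_eq]
  field_simp
  ring

/-- Moment generating function bound for a centered sum sampled without replacement. -/
theorem expect_exp_sum_perm_le (u : Fin n → ℝ) {r : ℝ} (hr : 0 < r) (hu : ∀ j, |u j| ≤ r)
    (h0 : ∑ j, u j = 0) (l : ℝ) (T : Finset (Fin n)) :
    (Finset.expect univ fun σ : Equiv.Perm (Fin n) => exp (l * ∑ t ∈ T, u (σ t))) ≤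
      exp (#T * ((l * r) ^ 2 / 2)) := by
  rcases T.eq_empty_or_nonempty with rfl | ⟨t, -⟩
  · simp
  have hn : (univ : Finset (Fin n)).Nonempty := ⟨t, mem_univ t⟩
  simp only [mul_sum, exp_sum]
  refine (expect_prod_perm_le (fun j => exp (l * u j)) (fun j => (exp_pos _).le) T).trans ?_
  rw [exp_nat_mul]
  refine pow_le_pow_left₀ (expect_nonneg fun j _ => (exp_pos _).le) ?_ _
  refine le_trans ?_ (cosh_le_exp_half_sq (l * r))
  calc (Finset.expect univ fun j => exp (l * u j))
      ≤ Finset.expect univ fun j => (cosh (l * r) + u j * (sinh (l * r) / r)) :=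
        expect_le_expect fun j _ => (exp_mul_le_cosh_add hr l (hu j)).trans
          (le_of_eq (by ring))
    _ = cosh (l * r) := by
        rw [expect_add_distrib, expect_const hn, ← expect_mul,
          Fintype.expect_eq_sum_div_card (f := u), h0]
        simp

/-- A common upper bound of `m` partial sums of centered, bounded vectors sampled without
replacement whose expectation grows like the square root of the sample size. -/
theorem exists_perm_sum_bound {m : ℕ} (u : Fin m → Fin n → ℝ) {r : ℝ} (hr : 0 < r)
    (hu : ∀ i j, |u i j| ≤ r) (h0 : ∀ i, ∑ j, u i j = 0) (T : Finset (Fin n))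
    (hT : T.Nonempty) :
    ∃ M : Equiv.Perm (Fin n) → ℝ, (∀ σ, 0 ≤ M σ) ∧ (∀ σ i, ∑ t ∈ T, u i (σ t) ≤ M σ) ∧
      (Finset.expect univ fun σ => M σ) ≤ r * √(#T : ℝ) * (log (m + 1) + 2) := by
  have hs : 0 < √(#T : ℝ) := sqrt_pos.2 (by exact_mod_cast hT.card_pos)
  have hs2 : √(#T : ℝ) ^ 2 = #T := sq_sqrt (by positivity)
  set q := r * √(#T : ℝ) with hq
  have hq0 : 0 < q := by positivity
  have hm : (0 : ℝ) < m + 1 := by positivity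
  have hL : 0 ≤ log ((m : ℝ) + 1) := log_nonneg (by linarith [Nat.cast_nonneg (α := ℝ) m])
  -- A smooth substitute for the maximum: `z + 1 ≤ exp z` at `z = v / q - log (m + 1)` bounds each
  -- sum `v`. At scale `q` each exponential has mean at most `exp (1/2) ≤ 2`.
  refine ⟨fun σ => q * (log (m + 1) + (∑ i, exp (q⁻¹ * ∑ t ∈ T, u i (σ t))) / (m + 1)),
    fun σ => ?_, fun σ i => ?_, ?_⟩
  · have : 0 ≤ ∑ i, exp (q⁻¹ * ∑ t ∈ T, u i (σ t)) := sum_nonneg fun i _ => (exp_pos _).le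
    positivity
  · have h1 : exp (q⁻¹ * ∑ t ∈ T, u i (σ t)) ≤ ∑ i, exp (q⁻¹ * ∑ t ∈ T, u i (σ t)) :=
      single_le_sum (f := fun i => exp (q⁻¹ * ∑ t ∈ T, u i (σ t)))
        (fun i _ => (exp_pos _).le) (mem_univ i)
    have h2 := add_one_le_exp (q⁻¹ * ∑ t ∈ T, u i (σ t) - log (m + 1))
    rw [exp_sub, exp_log hm] at h2
    have h3 := div_le_div_of_nonneg_right h1 hm.le
    calc ∑ t ∈ T, u i (σ t) = q * (q⁻¹ * ∑ t ∈ T, u i (σ t)) := by field_simp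
      _ ≤ _ := mul_le_mul_of_nonneg_left (by linarith) hq0.le
  · rw [← mul_expect]
    refine mul_le_mul_of_nonneg_left ?_ hq0.le
    rw [expect_add_distrib, expect_const univ_nonempty, ← expect_div, expect_sum_comm]
    have hb : ∀ i, (Finset.expect univ fun σ : Equiv.Perm (Fin n) =>
        exp (q⁻¹ * ∑ t ∈ T, u i (σ t))) ≤ 2 := by
      intro i
      refine (expect_exp_sum_perm_le (u i) hr (hu i) (h0 i) q⁻¹ T).trans ?_
      have : (#T : ℝ) * ((q⁻¹ * r) ^ 2 / 2) = 1 / 2 := by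
        rw [← hs2, hq]
        field_simp
      rw [this]
      have h4 := exp_one_lt_d9
      have h5 : exp (1 / 2) ^ 2 = exp 1 := by
        rw [← exp_nat_mul]
        norm_num
      nlinarith [exp_pos (1 / 2)]
    have hsum := sum_le_sum fun i (_ : i ∈ (univ : Finset (Fin m))) => hb i
    simp only [sum_const, card_univ, Fintype.card_fin, nsmul_eq_mul] at hsum
    have : (∑ i : Fin m, Finset.expect univ fun σ : Equiv.Perm (Fin n) =>
        exp (q⁻¹ * ∑ t ∈ T, u i (σ t))) / ((m : ℝ) + 1) ≤ 2 := by
      rw [div_le_iff₀ hm]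
      linarith
    linarith

end Sampling

/-! ### One dual step, and weak duality on a subset of the columns. -/

section Step

variable {m n : ℕ}

/-- The dual objective contribution `⟨d, y⟩ + [cⱼ - ⟨aⱼ, y⟩]₊` of one column. -/
def dualObj (d a : Fin m → ℝ) (cj : ℝ) (y : Fin m → ℝ) : ℝ :=
  d ⬝ᵥ y + max (cj - a ⬝ᵥ y) 0

theorem primalEstimate_eq_zero_or_one (a : Fin m → ℝ) (cj : ℝ) (y : Fin m → ℝ) :
    primalEstimate a cj y = 0 ∨ primalEstimate a cj y = 1 := by
  unfold primalEstimate
  split_ifs <;> simp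

theorem dualObj_eq (d a : Fin m → ℝ) (cj : ℝ) (y : Fin m → ℝ) :
    dualObj d a cj y = cj * primalEstimate a cj y + subgrad d a cj y ⬝ᵥ y := by
  unfold dualObj subgrad
  rw [sub_dotProduct, smul_dotProduct, smul_eq_mul]
  unfold primalEstimate
  split_ifs with h
  · rw [max_eq_left (by linarith)]
    ring
  · rw [max_eq_right (by linarith)]
    ring

theorem dualObj_nonneg {d a : Fin m → ℝ} {cj : ℝ} {y : Fin m → ℝ} (hd : 0 ≤ d) (hy : 0 ≤ y) :
    0 ≤ dualObj d a cj y :=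
  add_nonneg (dotProduct_nonneg_of_nonneg hd hy) (le_max_right _ _)

theorem subgrad_dotProduct_self_le {d a : Fin m → ℝ} {abar dbar : ℝ} (ha : ∀ i, |a i| ≤ abar)
    (hd : 0 ≤ d) (hd' : ∀ i, d i ≤ dbar) (cj : ℝ) (y : Fin m → ℝ) :
    subgrad d a cj y ⬝ᵥ subgrad d a cj y ≤ m * (abar + dbar) ^ 2 := by
  have : ∀ i ∈ (univ : Finset (Fin m)), subgrad d a cj y i * subgrad d a cj y i ≤
      (abar + dbar) ^ 2 := by
    intro i _
    rw [← sq, ← sq_abs]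
    refine pow_le_pow_left₀ (abs_nonneg _) ?_ 2
    have h1 := abs_le.1 (ha i)
    have h2 := hd' i
    have h3 : 0 ≤ d i := hd i
    simp only [subgrad, Pi.sub_apply, Pi.smul_apply, smul_eq_mul]
    rcases primalEstimate_eq_zero_or_one a cj y with h | h <;> rw [h, abs_le] <;>
      constructor <;> linarith
  simpa [dotProduct] using sum_le_sum this

/-- Taking positive parts does not increase squares, so the right side is just `‖y - γ g‖²`
expanded. -/
theorem dualStep_dotProduct_self_le (γ : ℝ) (d a : Fin m → ℝ) (cj : ℝ) (y : Fin m → ℝ) :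
    dualStep γ d a cj y ⬝ᵥ dualStep γ d a cj y ≤
      y ⬝ᵥ y - 2 * γ * (subgrad d a cj y ⬝ᵥ y) +
        γ ^ 2 * (subgrad d a cj y ⬝ᵥ subgrad d a cj y) := by
  simp only [dotProduct, mul_sum, ← sum_sub_distrib, ← sum_add_distrib]
  refine sum_le_sum fun i _ => ?_
  simp only [dualStep]
  rcases le_total (y i - γ * subgrad d a cj y i) 0 with h | h
  · rw [max_eq_right h]
    nlinarith [sq_nonneg (y i - γ * subgrad d a cj y i)]
  · rw [max_eq_left h]
    nlinarith

theorem norm_toLp_sq (y : Fin m → ℝ) : ‖WithLp.toLp 2 y‖ ^ 2 = y ⬝ᵥ y := by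
  rw [EuclideanSpace.norm_sq_eq]
  simp [dotProduct, ← sq]

theorem norm_toLp_le_sum {y : Fin m → ℝ} (hy : 0 ≤ y) : ‖WithLp.toLp 2 y‖ ≤ ∑ i, y i := by
  have h0 : 0 ≤ ∑ i, y i := sum_nonneg fun i _ => hy i
  refine (sq_le_sq₀ (norm_nonneg _) h0).1 ?_
  rw [norm_toLp_sq, sq, sum_mul]
  exact sum_le_sum fun i _ =>
    mul_le_mul_of_nonneg_left (single_le_sum (fun i _ => hy i) (mem_univ i)) (hy i)

theorem norm_toLp_mono {x y : Fin m → ℝ} (hx : 0 ≤ x) (hxy : x ≤ y) :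
    ‖WithLp.toLp 2 x‖ ≤ ‖WithLp.toLp 2 y‖ := by
  refine (sq_le_sq₀ (norm_nonneg _) (norm_nonneg _)).1 ?_
  rw [norm_toLp_sq, norm_toLp_sq]
  exact sum_le_sum fun i _ => mul_self_le_mul_self (hx i) (hxy i)

theorem dualStep_nonneg (γ : ℝ) (d a : Fin m → ℝ) (cj : ℝ) (y : Fin m → ℝ) :
    0 ≤ dualStep γ d a cj y := fun _ => le_max_right _ _

/-- The dual update stays in a ball around the origin. -/
theorem norm_dualStep_le {γ dlow dbar abar cbar : ℝ} (hγ : 0 ≤ γ) (hdlow : 0 < dlow)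
    {d a : Fin m → ℝ} {cj : ℝ} {y : Fin m → ℝ} (hd : ∀ i, dlow ≤ d i) (hd' : ∀ i, d i ≤ dbar)
    (ha : ∀ i, |a i| ≤ abar) (hc : |cj| ≤ cbar) (hG : 0 ≤ abar + dbar) (hy : 0 ≤ y)
    (hR : ‖WithLp.toLp 2 y‖ ≤
      (cbar + γ * (m * (abar + dbar) ^ 2) / 2) / dlow + γ * (√m * (abar + dbar))) :
    ‖WithLp.toLp 2 (dualStep γ d a cj y)‖ ≤
      (cbar + γ * (m * (abar + dbar) ^ 2) / 2) / dlow + γ * (√m * (abar + dbar)) := by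
  have hd0 : 0 ≤ d := fun i => hdlow.le.trans (hd i)
  have hg := subgrad_dotProduct_self_le ha hd0 hd' cj y
  have hstep := dualStep_dotProduct_self_le γ d a cj y
  set g := subgrad d a cj y with hgdef
  set R := (cbar + γ * (m * (abar + dbar) ^ 2) / 2) / dlow with hRdef
  have hcb : 0 ≤ cbar := (abs_nonneg _).trans hc
  have hR0 : 0 ≤ R := by positivity
  have hRd : R * dlow = cbar + γ * (m * (abar + dbar) ^ 2) / 2 := by
    rw [hRdef]
    field_simp
  have hgn : ‖WithLp.toLp 2 g‖ ≤ √m * (abar + dbar) := by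
    refine (sq_le_sq₀ (norm_nonneg _) (by positivity)).1 ?_
    rw [norm_toLp_sq, mul_pow, sq_sqrt (by positivity)]
    exact hg
  -- Inside radius `R` one step adds at most `γ ‖g‖`. Outside, `⟨g, y⟩ ≥ dlow ‖y‖ - cbar` is large
  -- enough to offset the quadratic term, so the norm does not grow.
  rcases le_total (‖WithLp.toLp 2 y‖) R with h | h
  · have h1 : ‖WithLp.toLp 2 (dualStep γ d a cj y)‖ ≤ ‖WithLp.toLp 2 (y - γ • g)‖ := by
      refine (sq_le_sq₀ (norm_nonneg _) (norm_nonneg _)).1 ?_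
      rw [norm_toLp_sq, norm_toLp_sq]
      refine hstep.trans (le_of_eq ?_)
      simp only [sub_dotProduct, dotProduct_sub, smul_dotProduct, dotProduct_smul, smul_eq_mul,
        dotProduct_comm y g]
      ring
    refine h1.trans ?_
    rw [WithLp.toLp_sub, WithLp.toLp_smul]
    refine (norm_sub_le _ _).trans (add_le_add h ?_)
    rw [norm_smul, norm_eq_abs, abs_of_nonneg hγ]
    exact mul_le_mul_of_nonneg_left hgn hγ
  · refine le_trans ?_ hR
    refine (sq_le_sq₀ (norm_nonneg _) (norm_nonneg _)).1 ?_
    rw [norm_toLp_sq, norm_toLp_sq]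
    have h2 : dlow * ‖WithLp.toLp 2 y‖ ≤ d ⬝ᵥ y := by
      refine (mul_le_mul_of_nonneg_left (norm_toLp_le_sum hy) hdlow.le).trans ?_
      rw [mul_sum]
      exact sum_le_sum fun i _ => mul_le_mul_of_nonneg_right (hd i) (hy i)
    have h3 : d ⬝ᵥ y - cbar ≤ g ⬝ᵥ y := by
      rw [hgdef, subgrad, sub_dotProduct, smul_dotProduct, smul_eq_mul]
      have := abs_le.1 hc
      unfold primalEstimate
      split_ifs with h4 <;> linarith
    have h5 : R * dlow ≤ dlow * ‖WithLp.toLp 2 y‖ := by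
      rw [mul_comm]
      exact mul_le_mul_of_nonneg_left h hdlow.le
    have h6 : γ * (m * (abar + dbar) ^ 2) / 2 ≤ g ⬝ᵥ y := by linarith
    nlinarith [mul_le_mul_of_nonneg_left h6 hγ, mul_le_mul_of_nonneg_left hg (sq_nonneg γ)]

/-- Weak duality for a subset `T` of the columns, compared with a primal point which is feasible
up to a relative violation `δ`. -/
theorem sum_dualObj_ge {A : Matrix (Fin m) (Fin n) ℝ} {d : Fin m → ℝ} {c x : Fin n → ℝ}
    {y : Fin m → ℝ} {cbar δ : ℝ} (T : Finset (Fin n)) (hδ : 0 ≤ δ) (hy : 0 ≤ y)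
    (hc : ∀ j, |c j| ≤ cbar) (hx0 : 0 ≤ x) (hx1 : x ≤ 1)
    (hA : ∀ i, ∑ j ∈ T, A i j * x j ≤ #T * d i * (1 + δ)) :
    ∑ j ∈ T, c j * x j - #T * cbar * δ ≤ ∑ j ∈ T, dualObj d (A.col j) (c j) y := by
  have hterm : ∀ j ∈ T, (1 + δ) * (d ⬝ᵥ y) + x j * (c j - A.col j ⬝ᵥ y) ≤
      (1 + δ) * dualObj d (A.col j) (c j) y := by
    intro j _
    have h0 : 0 ≤ x j := hx0 j
    have h1 : x j ≤ 1 := hx1 j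
    have hm0 : 0 ≤ max (c j - A.col j ⬝ᵥ y) 0 := le_max_right _ _
    have hm1 := mul_le_mul_of_nonneg_left (le_max_left (c j - A.col j ⬝ᵥ y) 0) h0
    have hm2 := mul_le_mul_of_nonneg_right h1 hm0
    have hm3 := mul_nonneg hδ hm0
    rw [dualObj]
    linarith
  have hsum := sum_le_sum hterm
  rw [← mul_sum, sum_add_distrib, sum_const, nsmul_eq_mul] at hsum
  have hswap : ∑ j ∈ T, x j * (A.col j ⬝ᵥ y) = ∑ i, (∑ j ∈ T, A i j * x j) * y i := by
    simp only [dotProduct, mul_sum, sum_mul, Matrix.col_apply]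
    rw [sum_comm]
    exact sum_congr rfl fun i _ => sum_congr rfl fun j _ => by ring
  have hle : ∑ j ∈ T, x j * (A.col j ⬝ᵥ y) ≤ #T * ((1 + δ) * (d ⬝ᵥ y)) := by
    rw [hswap, dotProduct, mul_sum, mul_sum]
    refine sum_le_sum fun i _ => (mul_le_mul_of_nonneg_right (hA i) (hy i)).trans ?_
    exact le_of_eq (by ring)
  simp only [mul_sub, sum_sub_distrib] at hsum
  have hV : ∑ j ∈ T, c j * x j ≤ #T * cbar := by
    rw [← nsmul_eq_mul]
    refine sum_le_card_nsmul _ _ _ fun j _ => ?_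
    have h0 : 0 ≤ x j := hx0 j
    have h1 : x j ≤ 1 := hx1 j
    have h2 := (le_abs_self _).trans (hc j)
    have h3 := (abs_nonneg _).trans (hc j)
    nlinarith
  simp only [mul_comm (c _)] at hV ⊢
  -- It remains to pass from `V ≤ (1 + δ) D` to `V - #T * cbar * δ ≤ D`, where `V` is the primal
  -- value on `T` and `D` the dual sum; this uses `V ≤ #T * cbar`.
  have h1δ : 0 < 1 + δ := by linarith
  have hcard : 0 ≤ (#T : ℝ) * cbar * δ * δ := by
    rcases T.eq_empty_or_nonempty with rfl | ⟨j, -⟩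
    · simp
    · have := (abs_nonneg _).trans (hc j)
      positivity
  refine le_of_mul_le_mul_left ?_ h1δ
  nlinarith [mul_le_mul_of_nonneg_left hV hδ]

end Step

/-! ### The whole trajectory: violation, regret and expected dual gap. -/

section Iterates

variable {m n : ℕ} {A : Matrix (Fin m) (Fin n) ℝ} {b : Fin m → ℝ} {c : Fin n → ℝ}
  {abar cbar dlow dbar γ : ℝ}

theorem dualIter_succ (σ : Equiv.Perm (Fin n)) (k : Fin n) :
    dualIter A b c γ σ (k + 1) = dualStep γ (avgRhs n b) (A.col (σ k)) (c (σ k))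
      (dualIter A b c γ σ k) := by
  rw [dualIter, dif_pos k.2]

theorem dualIter_nonneg (σ : Equiv.Perm (Fin n)) (k : ℕ) : 0 ≤ dualIter A b c γ σ k := by
  induction k with
  | zero => exact le_refl _
  | succ k ih =>
    rw [dualIter]
    split_ifs
    · exact dualStep_nonneg _ _ _ _ _
    · exact ih

/-- The dual iterate available at step `k` depends on the columns seen before only. -/
theorem dualIter_congr {σ τ : Equiv.Perm (Fin n)} (k : ℕ)
    (h : ∀ l : Fin n, (l : ℕ) < k → σ l = τ l) :
    dualIter A b c γ σ k = dualIter A b c γ τ k := by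
  induction k with
  | zero => rfl
  | succ k ih =>
    have ih' := ih fun l hl => h l (hl.trans (Nat.lt_succ_self k))
    simp only [dualIter]
    split_ifs with hk
    · rw [h ⟨k, hk⟩ (Nat.lt_succ_self k), ih']
    · exact ih'

theorem dualIter_zero_stepsize (σ : Equiv.Perm (Fin n)) (k : ℕ) :
    dualIter A b c 0 σ k = 0 := by
  induction k with
  | zero => rfl
  | succ k ih =>
    rw [dualIter, ih]
    split_ifs
    · ext i
      simp [dualStep]
    · rfl

theorem sum_mul_output (σ : Equiv.Perm (Fin n)) (v : Fin n → ℝ) :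
    ∑ j, v j * output A b c γ σ j = ∑ k : Fin n, v (σ k) *
      primalEstimate (A.col (σ k)) (c (σ k)) (dualIter A b c γ σ k) := by
  rw [← Equiv.sum_comp σ]
  simp [output]

theorem Assumptions.dlow_le (h : Assumptions A b c abar cbar dlow dbar) (i : Fin m) :
    dlow ≤ avgRhs n b i := h.min_rhs.2 ⟨i, rfl⟩

theorem Assumptions.le_dbar (h : Assumptions A b c abar cbar dlow dbar) (i : Fin m) :
    avgRhs n b i ≤ dbar := h.max_rhs.2 ⟨i, rfl⟩

theorem Assumptions.avgRhs_nonneg (h : Assumptions A b c abar cbar dlow dbar) :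
    0 ≤ avgRhs n b := fun i => h.dlow_pos.le.trans (h.dlow_le i)

theorem Assumptions.dims_pos (h : Assumptions A b c abar cbar dlow dbar) : 0 < m ∧ 0 < n := by
  obtain ⟨i, hi⟩ := h.min_rhs.1
  refine ⟨i.pos, Nat.pos_of_ne_zero ?_⟩
  rintro rfl
  have := h.dlow_pos
  simp [avgRhs] at hi
  linarith

theorem Assumptions.rhs_eq (h : Assumptions A b c abar cbar dlow dbar) (i : Fin m) :
    b i = n * avgRhs n b i := by
  have : (n : ℝ) ≠ 0 := by exact_mod_cast h.dims_pos.2.ne'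
  simp only [avgRhs]
  field_simp

theorem Assumptions.bounds (h : Assumptions A b c abar cbar dlow dbar) :
    0 ≤ abar ∧ 0 ≤ cbar ∧ 0 < dbar := by
  obtain ⟨i, -⟩ := h.min_rhs.1
  exact ⟨(abs_nonneg _).trans (h.col_bound ⟨0, h.dims_pos.2⟩ i),
    (abs_nonneg _).trans (h.cost_bound ⟨0, h.dims_pos.2⟩),
    h.dlow_pos.trans_le ((h.dlow_le i).trans (h.le_dbar i))⟩

theorem norm_dualIter_le (h : Assumptions A b c abar cbar dlow dbar) (hγ : 0 ≤ γ)
    (σ : Equiv.Perm (Fin n)) (k : ℕ) :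
    ‖WithLp.toLp 2 (dualIter A b c γ σ k)‖ ≤
      (cbar + γ * (m * (abar + dbar) ^ 2) / 2) / dlow + γ * (√m * (abar + dbar)) := by
  obtain ⟨ha, hc, hd⟩ := h.bounds
  have hl := h.dlow_pos
  induction k with
  | zero =>
    simp only [dualIter, WithLp.toLp_zero, norm_zero]
    positivity
  | succ k ih =>
    rw [dualIter]
    split_ifs with hk
    · exact norm_dualStep_le hγ hl h.dlow_le h.le_dbar (h.col_bound _) (h.cost_bound _)
        (by positivity) (dualIter_nonneg σ k) ih
    · exact ih

/-- Clipping at zero only raises an entry, so the increments dominate the unclipped steps and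
telescope from `0`. -/
theorem sum_subgrad_le_dualIter (σ : Equiv.Perm (Fin n)) (i : Fin m) :
    γ * ∑ k : Fin n, -subgrad (avgRhs n b) (A.col (σ k)) (c (σ k)) (dualIter A b c γ σ k) i ≤
      dualIter A b c γ σ n i := by
  rw [mul_sum]
  calc _ ≤ ∑ k : Fin n, (dualIter A b c γ σ (k + 1) i - dualIter A b c γ σ k i) := by
        refine sum_le_sum fun k _ => ?_
        rw [dualIter_succ]
        have := le_max_left (dualIter A b c γ σ k i - γ * subgrad (avgRhs n b) (A.col (σ k))
          (c (σ k)) (dualIter A b c γ σ k) i) 0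
        simp only [dualStep]
        linarith
    _ = _ := by
        rw [Fin.sum_univ_eq_sum_range
          (fun k => dualIter A b c γ σ (k + 1) i - dualIter A b c γ σ k i),
          sum_range_sub (fun k => dualIter A b c γ σ k i)]
        simp [dualIter]

theorem residual_eq (h : Assumptions A b c abar cbar dlow dbar) (σ : Equiv.Perm (Fin n))
    (i : Fin m) :
    (A *ᵥ output A b c γ σ) i - b i = ∑ k : Fin n,
      -subgrad (avgRhs n b) (A.col (σ k)) (c (σ k)) (dualIter A b c γ σ k) i := by
  rw [Matrix.mulVec, dotProduct, sum_mul_output, h.rhs_eq i]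
  simp [subgrad, sum_sub_distrib, mul_comm]

theorem violation_output_le (h : Assumptions A b c abar cbar dlow dbar) (hγ : 0 < γ)
    (σ : Equiv.Perm (Fin n)) :
    violation A b (output A b c γ σ) ≤
      cbar / (γ * dlow) + m * (abar + dbar) ^ 2 / (2 * dlow) + √m * (abar + dbar) := by
  have h1 : violation A b (output A b c γ σ) ≤
      ‖WithLp.toLp 2 (γ⁻¹ • dualIter A b c γ σ n)‖ := by
    refine norm_toLp_mono (fun i => le_max_right _ _) fun i => max_le ?_ ?_
    · rw [residual_eq h, Pi.smul_apply, smul_eq_mul, le_inv_mul_iff₀ hγ]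
      exact sum_subgrad_le_dualIter σ i
    · exact mul_nonneg (inv_nonneg.2 hγ.le) (dualIter_nonneg σ n i)
  refine h1.trans ?_
  rw [WithLp.toLp_smul, norm_smul, norm_eq_abs, abs_of_pos (inv_pos.2 hγ),
    inv_mul_le_iff₀ hγ]
  refine (norm_dualIter_le h hγ.le σ n).trans (le_of_eq ?_)
  have := h.dlow_pos
  field_simp

theorem sum_subgrad_dotProduct_le (h : Assumptions A b c abar cbar dlow dbar) (hγ : 0 ≤ γ)
    (σ : Equiv.Perm (Fin n)) :
    ∑ k : Fin n, subgrad (avgRhs n b) (A.col (σ k)) (c (σ k)) (dualIter A b c γ σ k) ⬝ᵥ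
      dualIter A b c γ σ k ≤ γ * (n * (m * (abar + dbar) ^ 2)) / 2 := by
  -- The telescoped inequality is divided by `2γ`; for `γ = 0` all iterates vanish.
  rcases hγ.eq_or_lt with rfl | hγ
  · simp [dualIter_zero_stepsize]
  have hstep : ∀ k ∈ (univ : Finset (Fin n)),
      2 * γ * (subgrad (avgRhs n b) (A.col (σ k)) (c (σ k)) (dualIter A b c γ σ k) ⬝ᵥ
      dualIter A b c γ σ k) ≤ γ ^ 2 * (m * (abar + dbar) ^ 2) -
      (dualIter A b c γ σ (k + 1) ⬝ᵥ dualIter A b c γ σ (k + 1) -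
        dualIter A b c γ σ k ⬝ᵥ dualIter A b c γ σ k) := by
    intro k _
    rw [dualIter_succ]
    have h1 := dualStep_dotProduct_self_le γ (avgRhs n b) (A.col (σ k)) (c (σ k))
      (dualIter A b c γ σ k)
    have h2 := mul_le_mul_of_nonneg_left (subgrad_dotProduct_self_le (a := A.col (σ k))
      (h.col_bound (σ k)) h.avgRhs_nonneg h.le_dbar (c (σ k)) (dualIter A b c γ σ k))
      (sq_nonneg γ)
    linarith
  have hsum := sum_le_sum hstep
  rw [← mul_sum, sum_sub_distrib, Fin.sum_univ_eq_sum_range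
    (fun k => dualIter A b c γ σ (k + 1) ⬝ᵥ dualIter A b c γ σ (k + 1) -
        dualIter A b c γ σ k ⬝ᵥ dualIter A b c γ σ k),
    sum_range_sub (fun k => dualIter A b c γ σ k ⬝ᵥ dualIter A b c γ σ k)] at hsum
  have h0 : dualIter A b c γ σ 0 ⬝ᵥ dualIter A b c γ σ 0 = 0 := by simp [dualIter]
  have hn : 0 ≤ dualIter A b c γ σ n ⬝ᵥ dualIter A b c γ σ n :=
    dotProduct_nonneg_of_nonneg (dualIter_nonneg σ n) (dualIter_nonneg σ n)
  simp only [sum_const, card_univ, Fintype.card_fin, nsmul_eq_mul] at hsum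
  refine le_of_mul_le_mul_left ?_ (by positivity : 0 < 2 * γ)
  refine hsum.trans ?_
  rw [h0]
  nlinarith

theorem optGap_output_le (h : Assumptions A b c abar cbar dlow dbar) (hγ : 0 ≤ γ)
    (σ : Equiv.Perm (Fin n)) :
    optGap A b c (output A b c γ σ) ≤ optValue A b c -
      ∑ k : Fin n, dualObj (avgRhs n b) (A.col (σ k)) (c (σ k)) (dualIter A b c γ σ k) +
      γ * (n * (m * (abar + dbar) ^ 2)) / 2 := by
  have := sum_subgrad_dotProduct_le h hγ σ
  rw [optGap, dotProduct, sum_mul_output]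
  simp only [dualObj_eq, sum_add_distrib]
  linarith

/-- Every column not seen yet is equally likely to arrive next. -/
theorem expect_dualObj_eq (k : Fin n) :
    ((n - k : ℕ) : ℝ) * (Finset.expect univ fun σ : Equiv.Perm (Fin n) =>
      dualObj (avgRhs n b) (A.col (σ k)) (c (σ k)) (dualIter A b c γ σ k)) =
    Finset.expect univ fun σ : Equiv.Perm (Fin n) => ∑ t ∈ Ici k,
      dualObj (avgRhs n b) (A.col (σ t)) (c (σ t)) (dualIter A b c γ σ k) := by
  rw [expect_sum_comm, ← Fin.card_Ici, ← nsmul_eq_mul, ← sum_const]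
  refine sum_congr rfl fun t ht => ?_
  -- Swapping positions `k` and `t ≥ k` leaves the columns before `k`, hence the iterate, unchanged.
  rw [← expect_perm_swap _ k t]
  refine expect_congr rfl fun σ _ => ?_
  have : dualIter A b c γ (σ * Equiv.swap k t) k = dualIter A b c γ σ k := by
    refine dualIter_congr _ fun l hl => ?_
    rw [Equiv.Perm.mul_apply, Equiv.swap_apply_of_ne_of_ne]
    · rintro rfl
      exact lt_irrefl _ hl
    · rintro rfl
      exact absurd (Fin.le_def.1 (mem_Ici.1 ht)) (by omega)
  rw [this]
  simp

theorem exists_optimal (h : Assumptions A b c abar cbar dlow dbar) :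
    ∃ x ∈ feasibleSet A b, c ⬝ᵥ x = optValue A b c := by
  refine (optValue_isGreatest A b c fun i => ?_).1
  rw [h.rhs_eq i]
  exact mul_nonneg (Nat.cast_nonneg n) (h.avgRhs_nonneg i)

theorem expect_dualObj_ge (h : Assumptions A b c abar cbar dlow dbar) (k : Fin n) :
    optValue A b c / n - 2 * (abar + 1) * cbar / dlow * (log (m + 1) + 2) / √((n - k : ℕ) : ℝ) ≤
    Finset.expect univ fun σ : Equiv.Perm (Fin n) =>
      dualObj (avgRhs n b) (A.col (σ k)) (c (σ k)) (dualIter A b c γ σ k) := by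
  obtain ⟨ha, hc, -⟩ := h.bounds
  have hl := h.dlow_pos
  have hn : (0 : ℝ) < n := by exact_mod_cast h.dims_pos.2
  obtain ⟨x, ⟨hAx, hx0, hx1⟩, hopt⟩ := exists_optimal h
  have hxa : ∀ i j, |A i j * x j| ≤ abar := fun i j => by
    have h0 : 0 ≤ x j := hx0 j
    have h1 : x j ≤ 1 := hx1 j
    rw [abs_mul, abs_of_nonneg h0]
    nlinarith [h.col_bound j i, abs_nonneg (A i j)]
  set μ : Fin m → ℝ := fun i => (∑ j, A i j * x j) / n with hμ
  have hμa : ∀ i, |μ i| ≤ abar := fun i => by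
    rw [hμ, abs_div, abs_of_pos hn, div_le_iff₀ hn]
    refine (abs_sum_le_sum_abs _ _).trans ((sum_le_sum fun j _ => hxa i j).trans ?_)
    simp [mul_comm]
  have hμd : ∀ i, μ i ≤ avgRhs n b i := fun i => by
    refine div_le_div_of_nonneg_right (hAx i) hn.le
  have hT : (Ici k).Nonempty := ⟨k, mem_Ici.2 le_rfl⟩
  obtain ⟨M, hM0, hM1, hM2⟩ := exists_perm_sum_bound (fun i j => A i j * x j - μ i)
    -- The centered entries are at most `2 * abar`; the extra `1` keeps `r` positive when `abar =
    -- 0`.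
    (r := 2 * (abar + 1)) (by linarith)
    (fun i j => by linarith [abs_sub (A i j * x j) (μ i), hxa i j, hμa i])
    (fun i => by
      simp only [sum_sub_distrib, sum_const, card_univ, Fintype.card_fin, nsmul_eq_mul, hμ]
      field_simp
      ring) (Ici k) hT
  have hcard : #(Ici k) = n - k := Fin.card_Ici k
  set s : ℝ := ((n - k : ℕ) : ℝ) with hs
  have hs0 : 0 < s := by
    rw [hs, ← hcard]
    exact_mod_cast hT.card_pos
  rw [hcard, ← hs] at hM2
  have hpt : ∀ σ : Equiv.Perm (Fin n), ∑ t ∈ Ici k, c (σ t) * x (σ t) - cbar / dlow * M σ ≤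
      ∑ t ∈ Ici k, dualObj (avgRhs n b) (A.col (σ t)) (c (σ t)) (dualIter A b c γ σ k) := by
    intro σ
    have := sum_dualObj_ge (A := A) (d := avgRhs n b) (c := c) (x := x)
      -- Since every right-hand side is at least `s * dlow`, this `δ` turns the absolute deviation
      -- `M σ` into a relative violation.
      (y := dualIter A b c γ σ k) (cbar := cbar) (δ := M σ / (s * dlow))
      ((Ici k).map σ.toEmbedding) (div_nonneg (hM0 σ) (by positivity))
      (dualIter_nonneg σ k) h.cost_bound hx0 hx1 ?_
    · simp only [sum_map, card_map, hcard, Equiv.coe_toEmbedding, ← hs] at this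
      refine le_trans (le_of_eq ?_) this
      field_simp
    · intro i
      simp only [sum_map, card_map, hcard, Equiv.coe_toEmbedding, ← hs]
      have h1 := hM1 σ i
      simp only [sum_sub_distrib, sum_const, hcard, nsmul_eq_mul, ← hs] at h1
      have h2 := mul_le_mul_of_nonneg_left (hμd i) hs0.le
      have h3 : M σ ≤ s * avgRhs n b i * (M σ / (s * dlow)) := by
        have : s * avgRhs n b i * (M σ / (s * dlow)) = avgRhs n b i / dlow * M σ := by
          field_simp
        rw [this]
        exact le_mul_of_one_le_left (hM0 σ) ((one_le_div hl).2 (h.dlow_le i))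
      linarith
  have hE := expect_le_expect fun σ (_ : σ ∈ (univ : Finset (Equiv.Perm (Fin n)))) => hpt σ
  rw [← expect_dualObj_eq, ← hs, expect_sub_distrib, ← mul_expect, expect_sum_comm] at hE
  have hval : ∀ t : Fin n, (Finset.expect univ fun σ : Equiv.Perm (Fin n) =>
      c (σ t) * x (σ t)) = optValue A b c / n := fun t => by
    rw [expect_perm_apply_eq (fun j => c j * x j) t, Fintype.expect_eq_sum_div_card,
      Fintype.card_fin, ← hopt]
    rfl
  simp only [hval, sum_const, hcard, nsmul_eq_mul, ← hs] at hE
  refine le_of_mul_le_mul_left (le_trans ?_ hE) hs0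
  have h4 := mul_le_mul_of_nonneg_left hM2 (by positivity : 0 ≤ cbar / dlow)
  have h5 : s * (2 * (abar + 1) * cbar / dlow * (log (m + 1) + 2) / √s) =
      cbar / dlow * (2 * (abar + 1) * √s * (log (m + 1) + 2)) := by
    have h6 : √s ≠ 0 := (sqrt_pos.2 hs0).ne'
    have h7 : s = √s * √s := (mul_self_sqrt hs0.le).symm
    field_simp
    rw [sq, ← h7]
    ring
  rw [mul_sub, h5]
  linarith

theorem sum_inv_sqrt_le (n : ℕ) : ∑ k ∈ range n, 1 / √((n - k : ℕ) : ℝ) ≤ 2 * √n := by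
  have h : ∀ n : ℕ, ∑ k ∈ range n, 1 / √((k + 1 : ℕ) : ℝ) ≤ 2 * √n := by
    intro n
    induction n with
    | zero => simp
    | succ n ih =>
      rw [sum_range_succ]
      have h1 : 0 < √((n + 1 : ℕ) : ℝ) := sqrt_pos.2 (by positivity)
      have h2 : √((n + 1 : ℕ) : ℝ) ^ 2 = n + 1 := by
        rw [sq_sqrt (by positivity)]
        push_cast
        ring
      have h3 : √(n : ℝ) ^ 2 = n := sq_sqrt (by positivity)
      have h4 : 1 / √((n + 1 : ℕ) : ℝ) ≤ 2 * √((n + 1 : ℕ) : ℝ) - 2 * √(n : ℝ) := by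
        rw [div_le_iff₀ h1]
        nlinarith [sq_nonneg (√((n + 1 : ℕ) : ℝ) - √(n : ℝ))]
      linarith
  rw [← sum_range_reflect]
  refine le_trans (le_of_eq (sum_congr rfl fun k hk => ?_)) (h n)
  have := mem_range.1 hk
  congr 4
  omega

theorem optValue_le (h : Assumptions A b c abar cbar dlow dbar) :
    optValue A b c ≤ ∑ j, max (c j) 0 := by
  obtain ⟨x, ⟨-, hx0, hx1⟩, hopt⟩ := exists_optimal h
  rw [← hopt]
  refine sum_le_sum fun j _ => ?_
  have h0 : 0 ≤ x j := hx0 j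
  have h1 : x j ≤ 1 := hx1 j
  nlinarith [le_max_left (c j) 0, le_max_right (c j) 0]

/-- The gap between the optimal value and the dual objective along the iterates. -/
theorem expect_dual_gap_le (h : Assumptions A b c abar cbar dlow dbar) :
    (Finset.expect univ fun σ : Equiv.Perm (Fin n) => (optValue A b c -
      ∑ k : Fin n, dualObj (avgRhs n b) (A.col (σ k)) (c (σ k)) (dualIter A b c γ σ k))) ≤
    (16 * (abar + 1) * cbar / dlow + 2 * cbar) * (m * log n + √n * log n) := by
  obtain ⟨ha, hc, -⟩ := h.bounds
  have hl := h.dlow_pos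
  obtain ⟨hm, hn⟩ := h.dims_pos
  have hnonneg : 0 ≤ log (n : ℝ) := log_natCast_nonneg n
  -- For `n = 1` the right side is zero, but the only iterate used is `0`, where the dual objective
  -- is `max c 0`, an upper bound for the optimum.
  rcases (Nat.succ_le_of_lt hn).eq_or_lt with h1 | h2
  · obtain rfl : n = 1 := h1.symm
    simp only [Nat.cast_one, log_one, mul_zero, add_zero]
    refine expect_le univ_nonempty fun σ _ => ?_
    have := optValue_le h
    simp only [univ_unique, sum_singleton] at this ⊢
    rw [Subsingleton.elim (σ default) default]
    simp only [Fin.default_eq_zero, Fin.val_zero, dualIter, dualObj, dotProduct_zero, sub_zero,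
      zero_add] at this ⊢
    linarith
  have hlog2 : (0.69 : ℝ) ≤ log n := by
    have h3 : log 2 ≤ log (n : ℝ) := log_le_log (by norm_num) (by exact_mod_cast h2)
    linarith [log_two_gt_d9]
  have hK : 0 ≤ (abar + 1) * cbar / dlow := by positivity
  -- If `n ≤ m`, the optimum is at most `n * cbar ≤ 2 * cbar * m * log n` and the dual objectives
  -- are nonnegative. If `m < n`, then `log (m + 1) ≤ log n`, and the added `2` is at most `3 * log
  -- n`.
  rcases le_or_gt n m with hnm | hmn
  · refine expect_le univ_nonempty fun σ _ => ?_
    have hopt : optValue A b c ≤ n * cbar := by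
      refine (optValue_le h).trans ((sum_le_card_nsmul _ _ cbar fun j _ => ?_).trans ?_)
      · exact max_le ((le_abs_self _).trans (h.cost_bound j)) hc
      · simp
    have hsum : 0 ≤ ∑ k : Fin n, dualObj (avgRhs n b) (A.col (σ k)) (c (σ k))
        (dualIter A b c γ σ k) :=
      sum_nonneg fun k _ => dualObj_nonneg h.avgRhs_nonneg (dualIter_nonneg σ k)
    have hnm' : (n : ℝ) ≤ m := by exact_mod_cast hnm
    have h3 : (n : ℝ) * cbar ≤ 2 * cbar * (m * log n) := by
      have h5 : (n : ℝ) ≤ 2 * (m * log n) := by nlinarith [Nat.cast_nonneg (α := ℝ) m]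
      calc (n : ℝ) * cbar ≤ 2 * (m * log n) * cbar := mul_le_mul_of_nonneg_right h5 hc
        _ = _ := by ring
    have h4 : 0 ≤ 16 * (abar + 1) * cbar / dlow * (m * log n + √n * log n) := by positivity
    have h6 : 0 ≤ 2 * cbar * (√n * log n) := by positivity
    linarith
  · rw [expect_sub_distrib, expect_const univ_nonempty, expect_sum_comm]
    have hsum := sum_le_sum fun k (_ : k ∈ (univ : Finset (Fin n))) =>
      expect_dualObj_ge (γ := γ) h k
    have hn' : (n : ℝ) ≠ 0 := by exact_mod_cast hn.ne'
    rw [sum_sub_distrib, Fin.sum_univ_eq_sum_range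
      (fun k => 2 * (abar + 1) * cbar / dlow * (log (m + 1) + 2) / √((n - k : ℕ) : ℝ))] at hsum
    simp only [sum_const, card_univ, Fintype.card_fin, nsmul_eq_mul, mul_div_cancel₀ _ hn']
      at hsum
    have h3 : ∑ k ∈ range n,
        2 * (abar + 1) * cbar / dlow * (log (m + 1) + 2) / √((n - k : ℕ) : ℝ) ≤
        2 * (abar + 1) * cbar / dlow * (log (m + 1) + 2) * (2 * √n) := by
      simp only [div_eq_mul_one_div (2 * (abar + 1) * cbar / dlow * (log (m + 1) + 2)),
        ← mul_sum]
      refine mul_le_mul_of_nonneg_left (sum_inv_sqrt_le n) ?_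
      have : 0 ≤ log ((m : ℝ) + 1) := log_nonneg (by linarith [Nat.cast_nonneg (α := ℝ) m])
      positivity
    have h4 : log ((m : ℝ) + 1) + 2 ≤ 4 * log n := by
      have : log ((m : ℝ) + 1) ≤ log n :=
        log_le_log (by positivity) (by exact_mod_cast hmn)
      linarith
    have h5 := mul_le_mul_of_nonneg_left h4
      (by positivity : 0 ≤ 4 * ((abar + 1) * cbar / dlow) * √n)
    have h6 : 0 ≤ 16 * (abar + 1) * cbar / dlow * (m * log n) := by positivity
    have h7 : 0 ≤ 2 * cbar * (m * log n + √n * log n) := by positivity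
    have h8 : 2 * (abar + 1) * cbar / dlow * (log (m + 1) + 2) * (2 * √n) =
      4 * ((abar + 1) * cbar / dlow) * √n * (log (m + 1) + 2) := by ring
    have h9 : 4 * ((abar + 1) * cbar / dlow) * √n * (4 * log n) =
      16 * (abar + 1) * cbar / dlow * (√n * log n) := by ring
    linarith

theorem stepsize_mul_eq (h : Assumptions A b c abar cbar dlow dbar) :
    stepsize m n abar cbar dlow dbar * (n * (m * (abar + dbar) ^ 2)) / 2 =
      √((abar + dbar) ^ 2 * cbar / (2 * dlow)) * √(m * n) := by
  obtain ⟨ha, hc, hd⟩ := h.bounds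
  have hl := h.dlow_pos
  obtain ⟨hm, hn⟩ := h.dims_pos
  have hm' : (0 : ℝ) < m := by exact_mod_cast hm
  have hn' : (0 : ℝ) < n := by exact_mod_cast hn
  rw [← sqrt_mul (by positivity), stepsize, eq_comm,
    sqrt_eq_iff_mul_self_eq (by positivity) (by positivity)]
  have := mul_self_sqrt (by positivity : 0 ≤ 2 * cbar / (dlow * (abar + dbar) ^ 2 * m * n))
  symm
  calc _ = (√(2 * cbar / (dlow * (abar + dbar) ^ 2 * m * n)) *
        √(2 * cbar / (dlow * (abar + dbar) ^ 2 * m * n))) *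
        (n * (m * (abar + dbar) ^ 2)) ^ 2 / 4 := by ring
    _ = _ := by
      rw [this]
      field_simp
      ring

/-- The stepsize equalizes `γ n m G² / 2` and `cbar / (γ dlow)`, where `G = abar + dbar`. -/
theorem div_stepsize_eq (h : Assumptions A b c abar cbar dlow dbar) (hc : 0 < cbar) :
    cbar / (stepsize m n abar cbar dlow dbar * dlow) =
      √((abar + dbar) ^ 2 * cbar / (2 * dlow)) * √(m * n) := by
  obtain ⟨ha, -, hd⟩ := h.bounds
  have hl := h.dlow_pos
  obtain ⟨hm, hn⟩ := h.dims_pos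
  have hm' : (0 : ℝ) < m := by exact_mod_cast hm
  have hn' : (0 : ℝ) < n := by exact_mod_cast hn
  have hpos : 0 < 2 * cbar / (dlow * (abar + dbar) ^ 2 * m * n) := by positivity
  have hγ : 0 < stepsize m n abar cbar dlow dbar := sqrt_pos.2 hpos
  rw [← stepsize_mul_eq h, div_eq_iff (by positivity)]
  have : stepsize m n abar cbar dlow dbar ^ 2 = _ := sq_sqrt hpos.le
  calc cbar = 2 * cbar / (dlow * (abar + dbar) ^ 2 * m * n) *
        (n * (m * (abar + dbar) ^ 2)) / 2 * dlow := by field_simp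
    _ = _ := by
      rw [← this]
      ring

theorem violation_output_stepsize_le (h : Assumptions A b c abar cbar dlow dbar)
    (σ : Equiv.Perm (Fin n)) :
    violation A b (output A b c (stepsize m n abar cbar dlow dbar) σ) ≤
      m * (abar + dbar) ^ 2 / dlow + √m * (abar + dbar) +
        √((abar + dbar) ^ 2 * cbar / (2 * dlow)) * √(m * n) := by
  obtain ⟨ha, hc, hd⟩ := h.bounds
  have hl := h.dlow_pos
  obtain ⟨hm, hn⟩ := h.dims_pos
  have hm' : (0 : ℝ) < m := by exact_mod_cast hm
  have hn' : (0 : ℝ) < n := by exact_mod_cast hn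
  -- If `cbar = 0`, the stepsize is zero and cannot be divided by; but then all costs vanish, the
  -- output is `0`, and nothing is violated.
  rcases hc.eq_or_lt with rfl | hc
  · have hout : output A b c (stepsize m n abar 0 dlow dbar) σ = 0 := by
      ext j
      have : c j = 0 := abs_nonpos_iff.1 (h.cost_bound j)
      simp [output, stepsize, dualIter_zero_stepsize, primalEstimate, this]
    have hv : violation A b (0 : Fin n → ℝ) = 0 := by
      have : (fun i => max ((A *ᵥ (0 : Fin n → ℝ)) i - b i) 0) = 0 := by
        ext i
        have : 0 ≤ b i := by
          rw [h.rhs_eq i]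
          exact mul_nonneg hn'.le (h.avgRhs_nonneg i)
        simpa using this
      rw [violation, this]
      simp
    rw [hout, hv]
    positivity
  · have hγ : 0 < stepsize m n abar cbar dlow dbar := sqrt_pos.2 (by positivity)
    have h1 := violation_output_le h hγ σ
    rw [div_stepsize_eq h hc] at h1
    have h2 : m * (abar + dbar) ^ 2 / (2 * dlow) ≤ m * (abar + dbar) ^ 2 / dlow :=
      div_le_div_of_nonneg_left (by positivity) hl (by linarith)
    linarith

end Iterates

end OnlineLP

theorem theorem1 (abar cbar dlow : ℝ) :
    ∃ C : ℝ, ∀ (dbar : ℝ) (m n : ℕ) (A : Matrix (Fin m) (Fin n) ℝ)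
      (b : Fin m → ℝ) (c : Fin n → ℝ),
      OnlineLP.Assumptions A b c abar cbar dlow dbar →
      (Finset.expect Finset.univ fun σ : Equiv.Perm (Fin n) =>
          OnlineLP.optGap A b c
            (OnlineLP.output A b c (OnlineLP.stepsize m n abar cbar dlow dbar) σ)) ≤
        C * (m * Real.log n + Real.sqrt n * Real.log n) +
          Real.sqrt ((abar + dbar) ^ 2 * cbar / (2 * dlow)) * Real.sqrt (m * n) ∧
      (Finset.expect Finset.univ fun σ : Equiv.Perm (Fin n) =>
          OnlineLP.violation A b
            (OnlineLP.output A b c (OnlineLP.stepsize m n abar cbar dlow dbar) σ)) ≤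
        m * (abar + dbar) ^ 2 / dlow + Real.sqrt m * (abar + dbar) +
          Real.sqrt ((abar + dbar) ^ 2 * cbar / (2 * dlow)) * Real.sqrt (m * n) := by
  -- The first summand serves the case `m < n`, the second `n ≤ m`.
  refine ⟨16 * (abar + 1) * cbar / dlow + 2 * cbar, fun dbar m n A b c h => ⟨?_, ?_⟩⟩
  · refine (Finset.expect_le_expect fun σ _ =>
      OnlineLP.optGap_output_le h (Real.sqrt_nonneg _) σ).trans ?_
    rw [Finset.expect_add_distrib, Finset.expect_const Finset.univ_nonempty]
    exact add_le_add (OnlineLP.expect_dual_gap_le h) (OnlineLP.stepsize_mul_eq h).le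
  · exact Finset.expect_le Finset.univ_nonempty fun σ _ =>
      OnlineLP.violation_output_stepsize_le h σ
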